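/- Let $\Omega\subset\mathbb{R}^3$ be open and let $\boldsymbol u=(u,v,w):\Omega\to\mathbb{R}^3$ be a three-channel volume image of class $C^2$ in the variables $(x,y,z)$. Let $\boldsymbol x_0\in\Omega$ be a point where the Jacobian matrix $\boldsymbol D:=\mathrm{D}\boldsymbol u(\boldsymbol x_0)$ satisfies $\det\boldsymbol D\neq0$. For $\varrho>0$ with $\boldsymbol x_0+B_\varrho\subset\Omega$, where $B_\varrho$ is the closed Euclidean ball of radius $\varrho$ around $\boldsymbol 0$, the space-continuous affine equivariant transformed $L^1$ median filter with structuring element $B_\varrho$ takes at $\boldsymbol x_0$ the value $$\boldsymbol u^*_\varrho(\boldsymbol x_0):=\boldsymbol D\,\hat{\boldsymbol u}^*,\qquad \hat{\boldsymbol u}^*:=\operatorname*{argmin}_{\boldsymbol m\in\mathbb{R}^3}\int_{\boldsymbol x_0+B_\varrho}\bigl\lVert\boldsymbol m-\boldsymbol D^{-1}\boldsymbol u(\boldsymbol x)\bigr\rVert\,\mathrm{d}\boldsymbol x ,$$ that is, the data are transformed by $\boldsymbol D^{-1}$, their $L^1$ median is taken, and it is transformed back by $\boldsymbol D$. Then this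 value exists and is unique, and, as $\varrho\to0$, the filter step approximates at $\boldsymbol x_0$ an explicit time step of size $\tau=\varrho^2/60$ of the PDE system $$\boldsymbol u_t=5(\boldsymbol u_{xx}+\boldsymbol u_{yy}+\boldsymbol u_{zz})+\boldsymbol A_1(\mathrm{D}\boldsymbol u)(\boldsymbol u_{yy}-\boldsymbol u_{xx})+\boldsymbol A_2(\mathrm{D}\boldsymbol u)(\boldsymbol u_{zz}-\boldsymbol u_{xx})-3\boldsymbol B_1(\mathrm{D}\boldsymbol u)\boldsymbol u_{xy}-3\boldsymbol B_2(\mathrm{D}\boldsymbol u)\boldsymbol u_{xz}-3\boldsymbol B_3(\mathrm{D}\boldsymbol u)\boldsymbol u_{yz},$$ in the sense that $$\boldsymbol u^*_\varrho(\boldsymbol x_0)=\boldsymbol u(\boldsymbol x_0)+\frac{\varrho^2}{60}\,\boldsymbol F(\boldsymbol x_0)+o(\varrho^2)\qquad(\varrho\to0^+),$$ where $\boldsymbol F(\boldsymbol x_0)$ is the right-hand side of the PDE system at $\boldsymbol x_0$. The coefficient matrices are $$\boldsymbol A_1(\boldsymbol D)=\boldsymbol I-3\boldsymbol D\,\mathrm{diag}(0,1,0)\,\boldsymbol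 D^{-1},\qquad \boldsymbol A_2(\boldsymbol D)=\boldsymbol I-3\boldsymbol D\,\mathrm{diag}(0,0,1)\,\boldsymbol D^{-1},$$ $$\boldsymbol B_1(\boldsymbol D)=\boldsymbol D\begin{pmatrix}0&1&0\\1&0&0\\0&0&0\end{pmatrix}\boldsymbol D^{-1},\quad \boldsymbol B_2(\boldsymbol D)=\boldsymbol D\begin{pmatrix}0&0&1\\0&0&0\\1&0&0\end{pmatrix}\boldsymbol D^{-1},\quad \boldsymbol B_3(\boldsymbol D)=\boldsymbol D\begin{pmatrix}0&0&0\\0&0&1\\0&1&0\end{pmatrix}\boldsymbol D^{-1}.$$ -/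

import Mathlib

open MeasureTheory Filter Topology Matrix

noncomputable section

/-- Euclidean three-space, both the image domain space and the value space. -/
abbrev E3 : Type := EuclideanSpace ℝ (Fin 3)

/-- The partial derivative `∂ⱼ u (x)` of a three-channel volume image (a vector of three channels). -/
def pd (j : Fin 3) (u : E3 → E3) (x : E3) : E3 :=
  fderiv ℝ u x (EuclideanSpace.single j 1)

/-- The second partial derivative `∂ⱼ ∂ᵢ u (x)`. -/
def pd2 (i j : Fin 3) (u : E3 → E3) (x : E3) : E3 :=
  pd j (pd i u) x

/-- The Jacobian matrix `Du(x)`; its entry in row `i`, column `j` is `∂ⱼ uᵢ (x)`. -/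
def jacobian (u : E3 → E3) (x : E3) : Matrix (Fin 3) (Fin 3) ℝ :=
  Matrix.of fun i j => pd j u x i

/-- A matrix acting on a vector of `E3`. -/
def act (A : Matrix (Fin 3) (Fin 3) ℝ) (v : E3) : E3 :=
  WithLp.toLp 2 (A *ᵥ WithLp.ofLp v)

/-- `m` is an `L¹` median of the data `f x`, where `x` is uniformly distributed over `s`: it
minimises the integral of the Euclidean distances to the data. -/
def IsL1Median (s : Set E3) (f : E3 → E3) (m : E3) : Prop :=
  IsMinOn (fun y : E3 => ∫ x in s, ‖y - f x‖) Set.univ m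

/-- `m` is a value at `x₀` of the affine equivariant transformed `L¹` median filter with the ball of
radius `ρ` as structuring element: the data `u x`, `x` in the ball around `x₀`, are transformed by
`Du(x₀)⁻¹`, their `L¹` median is determined, and it is transformed back by `Du(x₀)`. -/
def IsAffineL1MedianFilterValue (u : E3 → E3) (ρ : ℝ) (x₀ m : E3) : Prop :=
  ∃ mhat : E3,
    IsL1Median (Metric.closedBall x₀ ρ) (fun x => act (jacobian u x₀)⁻¹ (u x)) mhat ∧
    m = act (jacobian u x₀) mhat

/-- Coefficient matrix `A₁(D) = I - 3 D diag(0,1,0) D⁻¹`. -/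
def coeffA1 (D : Matrix (Fin 3) (Fin 3) ℝ) : Matrix (Fin 3) (Fin 3) ℝ :=
  1 - (3 : ℝ) • (D * Matrix.diagonal ![0, 1, 0] * D⁻¹)

/-- Coefficient matrix `A₂(D) = I - 3 D diag(0,0,1) D⁻¹`. -/
def coeffA2 (D : Matrix (Fin 3) (Fin 3) ℝ) : Matrix (Fin 3) (Fin 3) ℝ :=
  1 - (3 : ℝ) • (D * Matrix.diagonal ![0, 0, 1] * D⁻¹)

/-- Coefficient matrix `B₁(D)`. -/
def coeffB1 (D : Matrix (Fin 3) (Fin 3) ℝ) : Matrix (Fin 3) (Fin 3) ℝ :=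
  D * !![0, 1, 0; 1, 0, 0; 0, 0, 0] * D⁻¹

/-- Coefficient matrix `B₂(D)`. -/
def coeffB2 (D : Matrix (Fin 3) (Fin 3) ℝ) : Matrix (Fin 3) (Fin 3) ℝ :=
  D * !![0, 0, 1; 0, 0, 0; 1, 0, 0] * D⁻¹

/-- Coefficient matrix `B₃(D)`. -/
def coeffB3 (D : Matrix (Fin 3) (Fin 3) ℝ) : Matrix (Fin 3) (Fin 3) ℝ :=
  D * !![0, 0, 0; 0, 0, 1; 0, 1, 0] * D⁻¹

/-- The right-hand side at `x` of the PDE system `(u_t, v_t, w_t) = …` of the affine equivariant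
three-dimensional median filters; the coordinates `x, y, z` are numbered `0, 1, 2`. -/
def medianPDE (u : E3 → E3) (x : E3) : E3 :=
  (5 : ℝ) • (pd2 0 0 u x + pd2 1 1 u x + pd2 2 2 u x)
    + act (coeffA1 (jacobian u x)) (pd2 1 1 u x - pd2 0 0 u x)
    + act (coeffA2 (jacobian u x)) (pd2 2 2 u x - pd2 0 0 u x)
    - (3 : ℝ) • act (coeffB1 (jacobian u x)) (pd2 0 1 u x)
    - (3 : ℝ) • act (coeffB2 (jacobian u x)) (pd2 0 2 u x)
    - (3 : ℝ) • act (coeffB3 (jacobian u x)) (pd2 1 2 u x)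

end

/-! The transformed data `f = D⁻¹ u` have derivative `I` at `x₀`, so `f(x₀ + h) = f(x₀) + h +
Q(h,h)/2 + o(‖h‖²)` with `Q = D⁻¹ D²u(x₀)`. Put `x = x₀ + ρ y` and write a candidate median as
`f(x₀) + ρ² c`. Its distance to `f(x)` is `ρ ‖ρ h - y‖` with `h ≈ c - Q(y,y)/2`. Expand the norm at
`-y`: the part of the first order term that depends on `c` is odd in `y` and integrates to zero over
the ball. Hence, after subtracting terms independent of `c` and rescaling, the functional tends to
half the integral of the Hessian of the norm at `y`, evaluated at `c - Q(y,y)/2`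
(`HasExpansion.tendsto_integral_normQuotient`). This limit is a quadratic polynomial in `c`. Second
and fourth moments of the ball show that its unique minimiser is `medianCoeff`
(`integral_normHessian_sub`). Convexity of the functionals then forces the rescaled medians to
converge to it (`HasExpansion.tendsto_isL1Median`), and `60 D medianCoeff` is the right-hand side of
the PDE (`medianPDE_eq_act`). Existence follows from coercivity. Uniqueness holds because data with
invertible derivative at an interior point do not lie on a line. -/

/-! ### Taylor expansion -/

/-- Second order Taylor expansion with Peano remainder. -/
theorem taylor_two_isLittleO {E F : Type*} [NormedAddCommGroup E] [NormedSpace ℝ E]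
    [NormedAddCommGroup F] [NormedSpace ℝ F] {u : E → F} {x₀ : E} (hu : ContDiffAt ℝ 2 u x₀) :
    (fun h : E => u (x₀ + h) - u x₀ - fderiv ℝ u x₀ h
      - (1 / 2 : ℝ) • fderiv ℝ (fderiv ℝ u) x₀ h h) =o[𝓝 0] fun h => ‖h‖ ^ 2 := by
  set Q := fderiv ℝ (fderiv ℝ u) x₀ with hQ
  have hdiff : ∀ᶠ x in 𝓝 x₀, DifferentiableAt ℝ u x :=
    (hu.eventually (by simp)).mono fun x hx => hx.differentiableAt (by norm_num)
  have hQd : HasFDerivAt (fderiv ℝ u) Q x₀ :=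
    ((hu.fderiv_right (m := 1) (by norm_num)).differentiableAt (by norm_num)).hasFDerivAt
  have hsymm : ∀ v w, Q v w = Q w v := fun v w => (hu.isSymmSndFDerivAt (by simp)) v w
  have ho := hasFDerivAt_iff_isLittleO_nhds_zero.1 hQd
  rw [Asymptotics.isLittleO_iff]
  intro ε hε
  have hev : ∀ᶠ h in 𝓝 (0 : E), DifferentiableAt ℝ u (x₀ + h) := by
    have : Tendsto (fun h : E => x₀ + h) (𝓝 0) (𝓝 x₀) :=
      (by fun_prop : Continuous fun h : E => x₀ + h).tendsto' _ _ (by simp)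
    exact this.eventually hdiff
  obtain ⟨δ, hδ, hball⟩ := Metric.eventually_nhds_iff_ball.1
    (hev.and (Asymptotics.isLittleO_iff.1 ho hε))
  filter_upwards [Metric.ball_mem_nhds (0 : E) hδ] with h hh
  rw [mem_ball_zero_iff] at hh
  -- By symmetry of `Q` the remainder has derivative `u'(x₀ + z) - u'(x₀) - Q z`, which is at most
  -- `ε ‖h‖` on the ball of radius `‖h‖`; the mean value inequality supplies the second factor
  -- `‖h‖`.
  let g : E → F := fun h => u (x₀ + h) - u x₀ - fderiv ℝ u x₀ h - (1 / 2 : ℝ) • Q h h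
  have hg : ∀ z ∈ Metric.closedBall (0 : E) ‖h‖,
      HasFDerivWithinAt g (fderiv ℝ u (x₀ + z) - fderiv ℝ u x₀ - Q z)
        (Metric.closedBall 0 ‖h‖) z := by
    intro z hz
    have hz' : z ∈ Metric.ball (0 : E) δ := by
      rw [mem_closedBall_zero_iff] at hz
      rw [mem_ball_zero_iff]; exact hz.trans_lt hh
    have h1 : HasFDerivAt (fun h => u (x₀ + h)) (fderiv ℝ u (x₀ + z)) z :=
      (hasFDerivAt_comp_add_left x₀).2 (hball z hz').1.hasFDerivAt
    have h2 : HasFDerivAt (fun h => Q h h) (Q z + Q.flip z) z := by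
      refine (Q.hasFDerivAt.clm_apply (hasFDerivAt_id z)).congr_fderiv ?_
      ext w; simp
    have h3 := ((h1.sub_const (u x₀)).sub (fderiv ℝ u x₀).hasFDerivAt).sub
      (h2.const_smul (1 / 2 : ℝ))
    refine (h3.congr_fderiv ?_).hasFDerivWithinAt
    ext w
    simp only [_root_.sub_apply, _root_.smul_apply,
      _root_.add_apply, ContinuousLinearMap.flip_apply, hsymm w z]
    rw [← two_smul ℝ (Q z w), smul_smul]; norm_num
  have hb : ∀ z ∈ Metric.closedBall (0 : E) ‖h‖,
      ‖fderiv ℝ u (x₀ + z) - fderiv ℝ u x₀ - Q z‖ ≤ ε * ‖h‖ := by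
    intro z hz
    rw [mem_closedBall_zero_iff] at hz
    have := (hball z (by rw [mem_ball_zero_iff]; exact hz.trans_lt hh)).2
    exact this.trans (by gcongr)
  have key := Convex.norm_image_sub_le_of_norm_hasFDerivWithin_le hg hb
    (convex_closedBall 0 ‖h‖) (x := 0) (y := h) (by simp) (by simp)
  have hg0 : g 0 = 0 := by simp [g]
  rw [hg0] at key
  simpa [g, sq, mul_assoc] using key

/-! ### Matrix action and algebra of the PDE right-hand side -/

/-- The continuous linear map `v ↦ A v` on `E3`. -/
noncomputable def actCLM (A : Matrix (Fin 3) (Fin 3) ℝ) : E3 →L[ℝ] E3 :=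
  Matrix.toEuclideanCLM (𝕜 := ℝ) A

theorem actCLM_apply (A : Matrix (Fin 3) (Fin 3) ℝ) (v : E3) : actCLM A v = act A v := rfl

theorem act_act (A B : Matrix (Fin 3) (Fin 3) ℝ) (v : E3) : act A (act B v) = act (A * B) v := by
  simp [act, Matrix.mulVec_mulVec]

theorem act_one (v : E3) : act 1 v = v := by simp [act]

theorem act_apply (A : Matrix (Fin 3) (Fin 3) ℝ) (v : E3) (i : Fin 3) :
    act A v i = A i 0 * v 0 + A i 1 * v 1 + A i 2 * v 2 := by
  simp [act, Matrix.mulVec, dotProduct, Fin.sum_univ_three]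

theorem act_sub_smul (A B : Matrix (Fin 3) (Fin 3) ℝ) (t : ℝ) (v : E3) :
    act (A - t • B) v = act A v - t • act B v := by
  simp [act, Matrix.sub_mulVec, Matrix.smul_mulVec]

theorem E3_eq_sum (v : E3) : v = v 0 • EuclideanSpace.single 0 1 +
    v 1 • EuclideanSpace.single 1 1 + v 2 • EuclideanSpace.single 2 1 := by
  ext i; fin_cases i <;> simp

theorem fderiv_eq_act_jacobian (u : E3 → E3) (x h : E3) :
    fderiv ℝ u x h = act (jacobian u x) h := by
  conv_lhs => rw [E3_eq_sum h]
  ext i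
  simp [act_apply, jacobian, pd]
  ring

theorem pd2_eq_fderiv_fderiv {u : E3 → E3} {x : E3} (hu : ContDiffAt ℝ 2 u x) (i j : Fin 3) :
    pd2 i j u x = fderiv ℝ (fderiv ℝ u) x (EuclideanSpace.single j 1)
      (EuclideanSpace.single i 1) := by
  have hQd : DifferentiableAt ℝ (fderiv ℝ u) x :=
    (hu.fderiv_right (m := 1) (by norm_num)).differentiableAt (by norm_num)
  have := (hQd.hasFDerivAt.clm_apply (hasFDerivAt_const (EuclideanSpace.single i (1 : ℝ)) x)).fderiv
  unfold pd2 pd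
  rw [this]
  simp

/-- The leading coefficient of the `L¹` median of data `x + q(x)/2 + …`, where `q` is the quadratic
form with values `Q i j` on the coordinate vectors. -/
noncomputable def medianCoeff (Q : Fin 3 → Fin 3 → E3) : E3 :=
  (1 / 10 : ℝ) • ∑ i, Q i i - (1 / 20 : ℝ) • WithLp.toLp 2 fun i => ∑ j, Q i j j

/-- Every coefficient matrix is a combination of `I` and conjugates `D M D⁻¹`, so `D` factors out
once each second derivative is written as `D q`. What remains is a linear identity in the symmetric
family `q`. -/
theorem medianPDE_eq_act {u : E3 → E3} {x : E3} (hu : ContDiffAt ℝ 2 u x)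
    (hdet : (jacobian u x).det ≠ 0) :
    medianPDE u x = (60 : ℝ) • act (jacobian u x)
      (medianCoeff fun i j => act (jacobian u x)⁻¹ (pd2 i j u x)) := by
  set D := jacobian u x with hD
  have hDD : D * D⁻¹ = 1 := Matrix.mul_nonsing_inv D (isUnit_iff_ne_zero.2 hdet)
  have hsymm : ∀ i j, pd2 i j u x = pd2 j i u x := fun i j => by
    rw [pd2_eq_fderiv_fderiv hu, pd2_eq_fderiv_fderiv hu]
    exact (hu.isSymmSndFDerivAt (by simp)) _ _
  obtain ⟨q, hq⟩ : ∃ q : Fin 3 → Fin 3 → E3, ∀ i j, act D⁻¹ (pd2 i j u x) = q i j :=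
    ⟨_, fun _ _ => rfl⟩
  have hp : ∀ i j, pd2 i j u x = act D (q i j) := fun i j => by
    rw [← hq, act_act, hDD, act_one]
  have hqs : ∀ i j, q i j = q j i := fun i j => by rw [← hq, ← hq, hsymm]
  have hlin : ∀ v w, act D v - act D w = act D (v - w) := fun v w => by
    simp only [← actCLM_apply, map_sub]
  have hconj : ∀ M v, act (D * M * D⁻¹) (act D v) = act D (act M v) := fun M v => by
    rw [act_act, act_act, mul_assoc, mul_assoc, Matrix.nonsing_inv_mul D
      (isUnit_iff_ne_zero.2 hdet), mul_one]
  simp only [medianPDE, ← hD, coeffA1, coeffA2, coeffB1, coeffB2, coeffB3, hq]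
  simp only [hp, act_sub_smul, act_one, hlin, hconj]
  simp only [← actCLM_apply, ← map_add, ← map_sub, ← map_smul]
  congr 1
  simp only [actCLM_apply, medianCoeff]
  ext i
  fin_cases i <;>
    simp [act_apply, Fin.sum_univ_three, hqs 1 0, hqs 2 0, hqs 2 1] <;> ring

/-! ### Moments of radial weights on the unit ball -/

/-- Lebesgue measure on the open unit ball of `E3`. -/
noncomputable def ballMeasure : Measure E3 := volume.restrict (Metric.ball 0 1)

instance : IsFiniteMeasure ballMeasure := by
  unfold ballMeasure
  exact isFiniteMeasure_restrict.2 measure_ball_lt_top.ne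

theorem ae_ballMeasure_norm_lt : ∀ᵐ y ∂ballMeasure, ‖y‖ < 1 := by
  filter_upwards [ae_restrict_mem (μ := volume) (Metric.isOpen_ball (x := (0 : E3))).measurableSet]
    with y hy
  simpa using hy

theorem ae_ballMeasure_ne_zero : ∀ᵐ y ∂ballMeasure, y ≠ 0 :=
  ae_restrict_of_ae (Measure.ae_ne volume 0)

theorem integral_ballMeasure_comp_isometry (L : E3 ≃ₗᵢ[ℝ] E3) (F : E3 → ℝ) :
    ∫ y, F (L y) ∂ballMeasure = ∫ y, F y ∂ballMeasure := by
  have h := L.measurePreserving.restrict_preimage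
    (Metric.isOpen_ball (x := (0 : E3)) (ε := 1)).measurableSet
  rw [L.preimage_ball, map_zero] at h
  exact h.integral_comp L.toHomeomorph.measurableEmbedding F

/-- The reflection in the plane orthogonal to `a - b` sends `a` to `b` and preserves the ball. -/
theorem integral_inner_pow_congr (n : ℕ) (w : ℝ → ℝ) {a b : E3} (h : ‖a‖ = ‖b‖) :
    ∫ y, inner ℝ a y ^ n * w ‖y‖ ∂ballMeasure = ∫ y, inner ℝ b y ^ n * w ‖y‖ ∂ballMeasure := by
  let L := (Submodule.span ℝ {a - b})ᗮ.reflection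
  have hL : L a = b := Submodule.reflection_sub h
  rw [← integral_ballMeasure_comp_isometry L fun y => inner ℝ b y ^ n * w ‖y‖]
  simp only [← hL, L.inner_map_map, L.norm_map]

theorem integral_inner_pow (n : ℕ) (w : ℝ → ℝ) : ∃ t : ℝ, ∀ a : E3,
    ∫ y, inner ℝ a y ^ n * w ‖y‖ ∂ballMeasure = t * ‖a‖ ^ n := by
  refine ⟨∫ y, inner ℝ (EuclideanSpace.single 0 1 : E3) y ^ n * w ‖y‖ ∂ballMeasure, fun a => ?_⟩
  rw [integral_inner_pow_congr n w (b := ‖a‖ • EuclideanSpace.single 0 1) (by simp [norm_smul]),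
    ← integral_mul_const]
  refine integral_congr_ae (Eventually.of_forall fun y => ?_)
  simp only [inner_smul_left, mul_pow, RCLike.conj_to_real]
  ring

theorem integrable_mul_radial {n : ℕ} {w : ℝ → ℝ} (hwm : Measurable w)
    (hw : Integrable (fun y => ‖y‖ ^ n * w ‖y‖) ballMeasure) {p : E3 → ℝ} (hp : Continuous p)
    (C : ℝ) (hC : ∀ y, |p y| ≤ C * ‖y‖ ^ n) :
    Integrable (fun y => p y * w ‖y‖) ballMeasure := by
  refine (hw.norm.const_mul C).mono'
    (hp.measurable.mul (hwm.comp measurable_norm)).aestronglyMeasurable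
    (Eventually.of_forall fun y => ?_)
  rw [norm_mul, norm_mul, Real.norm_eq_abs, norm_pow, norm_norm, ← mul_assoc]
  gcongr
  exact hC y

theorem integrable_inner_mul_inner {w : ℝ → ℝ} (hwm : Measurable w)
    (hw : Integrable (fun y => ‖y‖ ^ 2 * w ‖y‖) ballMeasure) (a b : E3) :
    Integrable (fun y => inner ℝ a y * inner ℝ b y * w ‖y‖) ballMeasure := by
  refine integrable_mul_radial hwm hw (by fun_prop) (‖a‖ * ‖b‖) fun y => ?_
  rw [abs_mul]
  calc _ ≤ (‖a‖ * ‖y‖) * (‖b‖ * ‖y‖) := by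
        gcongr <;> exact abs_real_inner_le_norm _ _
    _ = _ := by ring

theorem integrable_inner_mul_inner_mul_inner_mul_inner {w : ℝ → ℝ} (hwm : Measurable w)
    (hw : Integrable (fun y => ‖y‖ ^ 4 * w ‖y‖) ballMeasure) (a b c d : E3) :
    Integrable (fun y => inner ℝ a y * inner ℝ b y * inner ℝ c y * inner ℝ d y * w ‖y‖)
      ballMeasure := by
  refine integrable_mul_radial hwm hw (by fun_prop) (‖a‖ * ‖b‖ * ‖c‖ * ‖d‖) fun y => ?_
  simp only [abs_mul]
  calc _ ≤ (‖a‖ * ‖y‖) * (‖b‖ * ‖y‖) * (‖c‖ * ‖y‖) * (‖d‖ * ‖y‖) := by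
        gcongr <;> exact abs_real_inner_le_norm _ _
    _ = _ := by ring

theorem norm_sq_eq_sum_inner_single (y : E3) :
    ‖y‖ ^ 2 = ∑ i : Fin 3, inner ℝ (EuclideanSpace.single i (1 : ℝ)) y *
      inner ℝ (EuclideanSpace.single i (1 : ℝ)) y := by
  rw [EuclideanSpace.real_norm_sq_eq]
  simp [EuclideanSpace.inner_single_left, sq]

/-- Second moments of a radial weight on the ball. -/
theorem integral_inner_mul_inner {w : ℝ → ℝ} (hwm : Measurable w)
    (hw : Integrable (fun y => ‖y‖ ^ 2 * w ‖y‖) ballMeasure) (a b : E3) :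
    ∫ y, inner ℝ a y * inner ℝ b y * w ‖y‖ ∂ballMeasure =
      (∫ y, ‖y‖ ^ 2 * w ‖y‖ ∂ballMeasure) / 3 * inner ℝ a b := by
  obtain ⟨t, ht⟩ := integral_inner_pow 2 w
  have hint : ∀ v : E3, Integrable (fun y => inner ℝ v y ^ 2 * w ‖y‖) ballMeasure := fun v => by
    simpa only [sq] using integrable_inner_mul_inner hwm hw v v
  have key : ∀ a b : E3, ∫ y, inner ℝ a y * inner ℝ b y * w ‖y‖ ∂ballMeasure =
      t * inner ℝ a b := by
    intro a b
    -- Polarisation reduces the bilinear moment to pure squares.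
    have h1 : (fun y => inner ℝ a y * inner ℝ b y * w ‖y‖) = fun y =>
        1 / 4 * (inner ℝ (a + b) y ^ 2 * w ‖y‖ - inner ℝ (a - b) y ^ 2 * w ‖y‖) := by
      funext y
      rw [inner_add_left, inner_sub_left]; ring
    rw [h1, integral_const_mul, integral_sub (hint _) (hint _), ht, ht, norm_add_sq_real,
      norm_sub_sq_real]
    ring
  -- Taking the trace over the standard basis determines `t`.
  have htr : ∫ y, ‖y‖ ^ 2 * w ‖y‖ ∂ballMeasure = 3 * t := by
    simp only [norm_sq_eq_sum_inner_single, Finset.sum_mul]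
    rw [integral_finsetSum _ fun i _ => integrable_inner_mul_inner hwm hw _ _]
    simp [key]
  rw [key, htr]; ring

/-- Fourth moments of a radial weight on the ball. -/
theorem integral_inner_mul_inner_mul_inner_mul_inner {w : ℝ → ℝ} (hwm : Measurable w)
    (hw : Integrable (fun y => ‖y‖ ^ 4 * w ‖y‖) ballMeasure) (a b c d : E3) :
    ∫ y, inner ℝ a y * inner ℝ b y * inner ℝ c y * inner ℝ d y * w ‖y‖ ∂ballMeasure =
      (∫ y, ‖y‖ ^ 4 * w ‖y‖ ∂ballMeasure) / 15 * (inner ℝ a b * inner ℝ c d +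
        inner ℝ a c * inner ℝ b d + inner ℝ a d * inner ℝ b c) := by
  obtain ⟨t, ht⟩ := integral_inner_pow 4 w
  have hint : ∀ v : E3, Integrable (fun y => inner ℝ v y ^ 4 * w ‖y‖) ballMeasure := fun v => by
    simpa only [pow_succ, pow_zero, one_mul] using
      integrable_inner_mul_inner_mul_inner_mul_inner hwm hw v v v v
  have key : ∀ a b c d : E3,
      ∫ y, inner ℝ a y * inner ℝ b y * inner ℝ c y * inner ℝ d y * w ‖y‖ ∂ballMeasure =
      t / 3 * (inner ℝ a b * inner ℝ c d + inner ℝ a c * inner ℝ b d +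
        inner ℝ a d * inner ℝ b c) := by
    intro a b c d
    -- Polarisation of a quartic form: eight sign patterns, weighted by the product of signs,
    -- isolate the mixed term with factor `192 = 8 · 4!`.
    let V : Fin 8 → E3 := ![a + b + c + d, a + b + c - d, a + b - c + d, a + b - c - d,
      a - b + c + d, a - b + c - d, a - b - c + d, a - b - c - d]
    let σ : Fin 8 → ℝ := ![1, -1, -1, 1, -1, 1, 1, -1]
    have h1 : (fun y => inner ℝ a y * inner ℝ b y * inner ℝ c y * inner ℝ d y * w ‖y‖) = fun y =>
        1 / 192 * ∑ i, σ i * (inner ℝ (V i) y ^ 4 * w ‖y‖) := by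
      funext y
      simp [V, σ, Fin.sum_univ_succ, inner_add_left, inner_sub_left]
      ring
    rw [h1, integral_const_mul, integral_finsetSum _ fun i _ => (hint _).const_mul _]
    have h4 : ∀ v : E3, ‖v‖ ^ 4 = inner ℝ v v ^ 2 := fun v => by
      rw [real_inner_self_eq_norm_sq]; ring
    simp only [integral_const_mul, ht, h4]
    simp [V, σ, Fin.sum_univ_succ, inner_add_left, inner_sub_left, inner_add_right,
      inner_sub_right, real_inner_comm a b, real_inner_comm a c, real_inner_comm a d,
      real_inner_comm b c, real_inner_comm b d, real_inner_comm c d, -inner_self_eq_norm_sq_to_K]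
    ring
  -- Double trace: the sum of `1 + 2 δᵢⱼ` over `i, j` is `15`, and `15 · t/3 = 5 t`.
  have htr : ∫ y, ‖y‖ ^ 4 * w ‖y‖ ∂ballMeasure = 5 * t := by
    have h4 : ∀ y : E3, ‖y‖ ^ 4 * w ‖y‖ = ∑ i : Fin 3, ∑ j : Fin 3,
        inner ℝ (EuclideanSpace.single i (1 : ℝ)) y * inner ℝ (EuclideanSpace.single i (1 : ℝ)) y *
        inner ℝ (EuclideanSpace.single j (1 : ℝ)) y * inner ℝ (EuclideanSpace.single j (1 : ℝ)) y *
        w ‖y‖ := fun y => by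
      have : ‖y‖ ^ 4 = ‖y‖ ^ 2 * ‖y‖ ^ 2 := by ring
      rw [this]
      simp only [norm_sq_eq_sum_inner_single, Fin.sum_univ_three]
      ring
    have hi := integrable_inner_mul_inner_mul_inner_mul_inner hwm hw
    simp only [h4]
    rw [integral_finsetSum _ fun i _ => integrable_finsetSum _ fun j _ => hi _ _ _ _]
    simp only [integral_finsetSum _ fun j _ => hi _ _ _ _, key]
    simp [Fin.sum_univ_three, EuclideanSpace.inner_single_left]
    ring
  rw [key, htr]; ring

theorem integral_radial_ballMeasure (f : ℝ → ℝ) : ∫ y, f ‖y‖ ∂ballMeasure =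
    3 * volume.real (Metric.ball (0 : E3) 1) * ∫ r in Set.Ioo (0 : ℝ) 1, r ^ 2 * f r := by
  have h := integral_fun_norm_addHaar (volume : Measure E3) (Set.indicator (Set.Iio 1) f)
  have h1 : (fun x : E3 => Set.indicator (Set.Iio 1) f ‖x‖) =
      Set.indicator (Metric.ball 0 1) fun x => f ‖x‖ := by
    funext x; simp [Set.indicator]
  have h2 : (fun r : ℝ => r ^ 2 • Set.indicator (Set.Iio 1) f r) =
      Set.indicator (Set.Iio 1) fun r => r ^ 2 * f r := by
    funext r; by_cases hr : r < 1 <;> simp [hr]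
  rw [h1, integral_indicator Metric.isOpen_ball.measurableSet, finrank_euclideanSpace_fin, h2,
    setIntegral_indicator measurableSet_Iio, Set.Ioi_inter_Iio] at h
  rw [ballMeasure, h]
  simp [mul_assoc]

theorem integrable_inv_norm : Integrable (fun y : E3 => ‖y‖⁻¹) ballMeasure := by
  refine (integrableOn_fun_norm_addHaar volume (f := fun r => r⁻¹) (r := 1)).2 ?_
  refine IntegrableOn.congr_fun (f := fun r : ℝ => r) ?_ (fun r hr => ?_) measurableSet_Ioo
  · exact (continuous_id.integrableOn_Icc (a := 0) (b := 1)).mono_set Set.Ioo_subset_Icc_self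
  · have : r ≠ 0 := hr.1.ne'
    simp; field_simp

theorem integral_inv_norm_ballMeasure :
    ∫ y, ‖y‖⁻¹ ∂ballMeasure = 3 / 2 * volume.real (Metric.ball (0 : E3) 1) := by
  rw [integral_radial_ballMeasure fun r => r⁻¹]
  have : ∫ r in Set.Ioo (0 : ℝ) 1, r ^ 2 * r⁻¹ = 1 / 2 := by
    rw [setIntegral_congr_fun (g := fun r : ℝ => r) measurableSet_Ioo fun r hr => by
      have : r ≠ 0 := hr.1.ne'
      simp only; field_simp, ← integral_Ioc_eq_integral_Ioo,
      ← intervalIntegral.integral_of_le zero_le_one, integral_id]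
    norm_num
  rw [this]; ring

/-- All later moments thereby become multiples of the single constant `∫ ‖y‖⁻¹`, whose value is
irrelevant beyond its positivity. -/
theorem integral_norm_ballMeasure :
    ∫ y, ‖y‖ ∂ballMeasure = (∫ y, ‖y‖⁻¹ ∂ballMeasure) / 2 := by
  rw [integral_inv_norm_ballMeasure, integral_radial_ballMeasure fun r => r]
  have : ∫ r in Set.Ioo (0 : ℝ) 1, r ^ 2 * r = 1 / 4 := by
    simp only [← pow_succ]
    rw [← integral_Ioc_eq_integral_Ioo, ← intervalIntegral.integral_of_le zero_le_one,
      integral_pow]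
    norm_num
  rw [this]; ring

theorem integral_inv_norm_pos : 0 < ∫ y, ‖y‖⁻¹ ∂ballMeasure := by
  rw [integral_inv_norm_ballMeasure]
  have : 0 < volume.real (Metric.ball (0 : E3) 1) :=
    ENNReal.toReal_pos (Metric.measure_ball_pos _ _ one_pos).ne' measure_ball_lt_top.ne
  positivity

/-! ### Existence and uniqueness of the `L¹` median -/

theorem IsL1Median.integral_le {s : Set E3} {f : E3 → E3} {m : E3} (hm : IsL1Median s f m)
    (n : E3) : ∫ x in s, ‖m - f x‖ ≤ ∫ x in s, ‖n - f x‖ :=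
  isMinOn_univ_iff.1 hm n

theorem integrableOn_norm_sub {s : Set E3} (hs : IsCompact s) {f : E3 → E3}
    (hf : ContinuousOn f s) (m : E3) : IntegrableOn (fun x => ‖m - f x‖) s :=
  (continuousOn_const.sub hf).norm.integrableOn_compact hs

theorem convexOn_integral_norm_sub {s : Set E3} (hs : IsCompact s) {f : E3 → E3}
    (hf : ContinuousOn f s) : ConvexOn ℝ Set.univ fun m : E3 => ∫ x in s, ‖m - f x‖ := by
  refine ⟨convex_univ, fun m _ n _ a b ha hb hab => ?_⟩
  have hm := (integrableOn_norm_sub hs hf m).const_mul a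
  have hn := (integrableOn_norm_sub hs hf n).const_mul b
  simp only [smul_eq_mul]
  rw [← integral_const_mul, ← integral_const_mul, ← integral_add hm hn]
  refine integral_mono (integrableOn_norm_sub hs hf _) (hm.add hn) fun x => ?_
  have : a • m + b • n - f x = a • (m - f x) + b • (n - f x) := by
    rw [smul_sub, smul_sub, sub_add_sub_comm, ← add_smul, hab, one_smul]
  simp only [this]
  refine (norm_add_le _ _).trans ?_
  rw [norm_smul, norm_smul, Real.norm_of_nonneg ha, Real.norm_of_nonneg hb]

/-- The functional is convex, hence continuous in finite dimension, and it grows at least like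
`vol(s) ‖m‖` minus a constant. -/
theorem exists_isL1Median {s : Set E3} (hs : IsCompact s) (hpos : volume s ≠ 0) {f : E3 → E3}
    (hf : ContinuousOn f s) : ∃ m, IsL1Median s f m := by
  have hint := integrableOn_norm_sub hs hf
  have hcont : Continuous fun m : E3 => ∫ x in s, ‖m - f x‖ :=
    continuousOn_univ.1 <| (convexOn_integral_norm_sub hs hf).continuousOn isOpen_univ
  have hV : 0 < volume.real s := ENNReal.toReal_pos hpos hs.measure_lt_top.ne
  have hlow : ∀ m : E3, volume.real s * ‖m‖ - ∫ x in s, ‖0 - f x‖ ≤ ∫ x in s, ‖m - f x‖ := by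
    intro m
    have : volume.real s * ‖m‖ = ∫ _ in s, ‖m‖ := by simp
    have hc : IntegrableOn (fun _ : E3 => ‖m‖) s := integrableOn_const hs.measure_lt_top.ne
    rw [this, ← integral_sub hc (hint 0)]
    refine integral_mono (hc.sub (hint 0)) (hint m) fun x => ?_
    simpa using norm_sub_norm_le m (f x)
  have htend : Tendsto (fun m : E3 => ∫ x in s, ‖m - f x‖) (cocompact E3) atTop :=
    tendsto_atTop_mono hlow <| tendsto_atTop_add_const_right _ _ <|
      (tendsto_norm_cocompact_atTop).const_mul_atTop hV
  obtain ⟨m, hm⟩ := hcont.exists_forall_le htend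
  exact ⟨m, fun y _ => hm y⟩

/-- Distinct vectors on a common ray are multiples of their difference. -/
theorem inner_eq_zero_of_sameRay {a b e : E3} (h : SameRay ℝ a b) (hab : a ≠ b)
    (he : inner ℝ e (a - b) = 0) : inner ℝ e a = 0 := by
  rw [inner_sub_right, sub_eq_zero] at he
  rcases h with rfl | rfl | ⟨r, t, hr, ht, hrt⟩
  · simp
  · simpa using he
  · have h1 : r * inner ℝ e a = t * inner ℝ e a := by
      have := congrArg (inner ℝ e) hrt
      simp only [inner_smul_right] at this
      rw [this, he]
    by_contra h0
    have : r = t := mul_right_cancel₀ h0 h1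
    subst this
    exact hab (smul_right_injective _ hr.ne' hrt)

theorem exists_ne_zero_inner_eq_zero (d : E3) : ∃ e : E3, e ≠ 0 ∧ inner ℝ e d = 0 := by
  have hfr : (ℝ ∙ d)ᗮ ≠ ⊥ := by
    intro h
    have h1 := Submodule.finrank_add_finrank_orthogonal (ℝ ∙ d)
    rw [h, finrank_euclideanSpace_fin, finrank_bot] at h1
    have := finrank_span_le_card (R := ℝ) ({d} : Set E3)
    simp at this
    omega
  obtain ⟨e, he, he0⟩ := Submodule.exists_mem_ne_zero_of_ne_bot hfr
  exact ⟨e, he0, by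
    rw [real_inner_comm]
    exact Submodule.mem_orthogonal_singleton_iff_inner_right.1 he⟩

/-- If the data have the identity as derivative at an interior point, then they are not contained
in a line, and the `L¹` median is unique. -/
theorem IsL1Median.unique {s : Set E3} (hs : IsCompact s) {f : E3 → E3} (hf : ContinuousOn f s)
    {x₀ : E3} (hx₀ : s ∈ 𝓝 x₀) (hd : HasFDerivAt f (ContinuousLinearMap.id ℝ E3) x₀)
    {m n : E3} (hm : IsL1Median s f m) (hn : IsL1Median s f n) : m = n := by
  by_contra hmn
  have hint := integrableOn_norm_sub hs hf
  -- Both endpoints are minimisers, so at the midpoint the triangle inequality is an equality almost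
  -- everywhere, and by continuity everywhere in the interior.
  let z : E3 := (1 / 2 : ℝ) • m + (1 / 2 : ℝ) • n
  have hzf : ∀ x, z - f x = (1 / 2 : ℝ) • ((m - f x) + (n - f x)) := fun x => by
    simp only [z]; module
  let k : E3 → ℝ := fun x => ‖m - f x‖ + ‖n - f x‖ - 2 * ‖z - f x‖
  have hk0 : ∀ x, 0 ≤ k x := fun x => by
    simp only [k, hzf, norm_smul]
    norm_num
    linarith [norm_add_le (m - f x) (n - f x)]
  have hki : IntegrableOn k s := ((hint m).add (hint n)).sub ((hint z).const_mul 2)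
  have hkz : ∫ x in s, k x = 0 := by
    refine le_antisymm ?_ (integral_nonneg hk0)
    have hadd : IntegrableOn (fun x => ‖m - f x‖ + ‖n - f x‖) s := (hint m).add (hint n)
    simp only [k]
    rw [integral_sub hadd ((hint z).const_mul 2),
      integral_add (hint m) (hint n), integral_const_mul]
    linarith [hm.integral_le z, hn.integral_le z]
  have hae : k =ᵐ[volume.restrict s] 0 := (integral_eq_zero_iff_of_nonneg hk0 hki).1 hkz
  have hkc : ContinuousOn k (interior s) :=
    (((continuousOn_const.sub hf).norm.add (continuousOn_const.sub hf).norm).sub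
      (continuousOn_const.mul (continuousOn_const.sub hf).norm)).mono interior_subset
  have hkint : Set.EqOn k 0 (interior s) := Measure.eqOn_open_of_ae_eq
    (ae_mono (Measure.restrict_mono interior_subset le_rfl) hae) isOpen_interior hkc
    continuousOn_const
  obtain ⟨e, he0, he⟩ := exists_ne_zero_inner_eq_zero (m - n)
  -- Near `x₀` the data lie on the line through `m` and `n`, so the derivative of `f` would
  -- annihilate the direction `e` orthogonal to it; but that derivative is the identity.
  have hline : (fun x => inner ℝ e (m - f x)) =ᶠ[𝓝 x₀] fun _ => 0 := by
    filter_upwards [interior_mem_nhds.2 hx₀] with x hx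
    refine inner_eq_zero_of_sameRay (b := n - f x) ?_ (fun h => hmn (sub_left_injective h))
      (by simpa using he)
    rw [sameRay_iff_norm_add]
    have : k x = 0 := hkint hx
    simp only [k, hzf, norm_smul] at this
    norm_num at this
    linarith
  have h1 : HasFDerivAt (fun x => inner ℝ e (m - f x))
      ((innerSL ℝ e).comp (-ContinuousLinearMap.id ℝ E3)) x₀ :=
    (innerSL ℝ e).hasFDerivAt.comp x₀ (hd.const_sub m)
  have h2 := h1.unique ((hasFDerivAt_const (0 : ℝ) x₀).congr_of_eventuallyEq hline)
  have h3 := congrArg (fun L => L e) h2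
  simp at h3
  exact he0 h3

/-! ### Hessian of the norm and the limit functional -/

/-- `‖y‖⁻¹` times the inner product of the components of `v` and `w` orthogonal to `y`; this is the
second derivative of the norm at `y`. -/
noncomputable def normHessian (v w y : E3) : ℝ :=
  inner ℝ v w * ‖y‖⁻¹ - inner ℝ v y * inner ℝ w y * (‖y‖ ^ 3)⁻¹

theorem abs_normHessian_le (v w y : E3) : |normHessian v w y| ≤ 2 * (‖v‖ * ‖w‖) * ‖y‖⁻¹ := by
  have h1 : |inner ℝ v w * ‖y‖⁻¹| ≤ ‖v‖ * ‖w‖ * ‖y‖⁻¹ := by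
    rw [abs_mul, abs_of_nonneg (inv_nonneg.2 (norm_nonneg y))]
    gcongr
    exact abs_real_inner_le_norm _ _
  have h2 : |inner ℝ v y * inner ℝ w y * (‖y‖ ^ 3)⁻¹| ≤ ‖v‖ * ‖w‖ * ‖y‖⁻¹ := by
    rw [abs_mul, abs_mul, abs_of_nonneg (by positivity : 0 ≤ (‖y‖ ^ 3)⁻¹)]
    calc _ ≤ (‖v‖ * ‖y‖) * (‖w‖ * ‖y‖) * (‖y‖ ^ 3)⁻¹ := by
          gcongr <;> exact abs_real_inner_le_norm _ _
      _ = _ := by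
          rcases eq_or_ne ‖y‖ 0 with h | h
          · simp [h]
          · field_simp
  unfold normHessian
  linarith [abs_sub (inner ℝ v w * ‖y‖⁻¹) (inner ℝ v y * inner ℝ w y * (‖y‖ ^ 3)⁻¹)]

theorem integrable_normHessian {h k : E3 → E3} (hh : Continuous h) (hk : Continuous k) :
    Integrable (fun y => normHessian (h y) (k y) y) ballMeasure := by
  obtain ⟨C, hC⟩ := (isCompact_closedBall (0 : E3) 1).exists_bound_of_continuousOn
    (hh.norm.mul hk.norm).continuousOn
  refine (integrable_inv_norm.const_mul (2 * C)).mono' ?_ ?_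
  · unfold normHessian
    exact (by fun_prop : Measurable _).aestronglyMeasurable
  · filter_upwards [ae_ballMeasure_norm_lt] with y hy
    refine (abs_normHessian_le _ _ _).trans ?_
    gcongr
    simpa using hC y (by simpa using hy.le)

theorem norm_sq_mul_inv_cube (y : E3) : ‖y‖ ^ 2 * (‖y‖ ^ 3)⁻¹ = ‖y‖⁻¹ := by
  rcases eq_or_ne ‖y‖ 0 with h | h
  · simp [h]
  · field_simp

theorem norm_sq_mul_inv (y : E3) : ‖y‖ ^ 2 * ‖y‖⁻¹ = ‖y‖ := by
  rcases eq_or_ne ‖y‖ 0 with h | h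
  · simp [h]
  · field_simp

theorem norm_pow_four_mul_inv_cube (y : E3) : ‖y‖ ^ 4 * (‖y‖ ^ 3)⁻¹ = ‖y‖ := by
  rcases eq_or_ne ‖y‖ 0 with h | h
  · simp [h]
  · field_simp

theorem integrable_norm_ballMeasure : Integrable (fun y : E3 => ‖y‖) ballMeasure := by
  refine (integrable_const (1 : ℝ)).mono' continuous_norm.aestronglyMeasurable ?_
  filter_upwards [ae_ballMeasure_norm_lt] with y hy
  simpa using hy.le

theorem integral_normHessian_const (v w : E3) : ∫ y, normHessian v w y ∂ballMeasure =
    2 / 3 * (∫ y, ‖y‖⁻¹ ∂ballMeasure) * inner ℝ v w := by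
  have hw : Integrable (fun y : E3 => ‖y‖ ^ 2 * (‖y‖ ^ 3)⁻¹) ballMeasure := by
    simpa only [norm_sq_mul_inv_cube] using integrable_inv_norm
  have hm : Measurable fun r : ℝ => (r ^ 3)⁻¹ := by fun_prop
  unfold normHessian
  rw [integral_sub (integrable_inv_norm.const_mul _) (integrable_inner_mul_inner hm hw v w),
    integral_const_mul, integral_inner_mul_inner hm hw]
  simp only [norm_sq_mul_inv_cube]
  ring

theorem apply_apply_eq_sum (Q : E3 →L[ℝ] E3 →L[ℝ] E3) (y : E3) : Q y y = ∑ i : Fin 3, ∑ j : Fin 3,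
    (inner ℝ (EuclideanSpace.single i (1 : ℝ)) y * inner ℝ (EuclideanSpace.single j (1 : ℝ)) y) •
      Q (EuclideanSpace.single j 1) (EuclideanSpace.single i 1) := by
  conv_lhs => rw [E3_eq_sum y]
  simp [EuclideanSpace.inner_single_left, Fin.sum_univ_three]
  module

theorem integral_normHessian_quadratic (Q : E3 →L[ℝ] E3 →L[ℝ] E3) (hQ : ∀ v w, Q v w = Q w v)
    (v : E3) : ∫ y, normHessian v (Q y y) y ∂ballMeasure = 4 / 3 * (∫ y, ‖y‖⁻¹ ∂ballMeasure) *
      inner ℝ v (medianCoeff fun i j =>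
        Q (EuclideanSpace.single j 1) (EuclideanSpace.single i 1)) := by
  let e : Fin 3 → E3 := fun i => EuclideanSpace.single i 1
  have hw1 : Integrable (fun y : E3 => ‖y‖ ^ 2 * ‖y‖⁻¹) ballMeasure := by
    simpa only [norm_sq_mul_inv] using integrable_norm_ballMeasure
  have hw3 : Integrable (fun y : E3 => ‖y‖ ^ 4 * (‖y‖ ^ 3)⁻¹) ballMeasure := by
    simpa only [norm_pow_four_mul_inv_cube] using integrable_norm_ballMeasure
  have hm1 : Measurable fun r : ℝ => r⁻¹ := by fun_prop
  have hm3 : Measurable fun r : ℝ => (r ^ 3)⁻¹ := by fun_prop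
  -- The weights reduce both moments to `∫ ‖y‖`, which is half of `∫ ‖y‖⁻¹`; hence `1/6 = 1/2 · 1/3`
  -- here and `1/30 = 1/2 · 1/15` below.
  have h2 : ∀ a b : E3, ∫ y, inner ℝ a y * inner ℝ b y * ‖y‖⁻¹ ∂ballMeasure =
      (∫ y, ‖y‖⁻¹ ∂ballMeasure) / 6 * inner ℝ a b := fun a b => by
    rw [integral_inner_mul_inner hm1 hw1]
    simp only [norm_sq_mul_inv, integral_norm_ballMeasure]
    ring
  have h4 : ∀ a b c d : E3, ∫ y, inner ℝ a y * inner ℝ b y * inner ℝ c y * inner ℝ d y *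
      (‖y‖ ^ 3)⁻¹ ∂ballMeasure = (∫ y, ‖y‖⁻¹ ∂ballMeasure) / 30 *
        (inner ℝ a b * inner ℝ c d + inner ℝ a c * inner ℝ b d + inner ℝ a d * inner ℝ b c) :=
    fun a b c d => by
      rw [integral_inner_mul_inner_mul_inner_mul_inner hm3 hw3]
      simp only [norm_pow_four_mul_inv_cube, integral_norm_ballMeasure]
      ring
  have i2 := integrable_inner_mul_inner hm1 hw1
  have i4 := integrable_inner_mul_inner_mul_inner_mul_inner hm3 hw3
  have hexp : ∀ y, normHessian v (Q y y) y = ∑ i : Fin 3, ∑ j : Fin 3,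
      (inner ℝ v (Q (e j) (e i)) * (inner ℝ (e i) y * inner ℝ (e j) y * ‖y‖⁻¹) -
      inner ℝ v y * inner ℝ (Q (e j) (e i)) y * inner ℝ (e i) y * inner ℝ (e j) y *
        (‖y‖ ^ 3)⁻¹) := fun y => by
    unfold normHessian
    rw [apply_apply_eq_sum]
    simp only [inner_sum, sum_inner, inner_smul_left, inner_smul_right, RCLike.conj_to_real,
      Finset.sum_mul, Finset.mul_sum, ← Finset.sum_sub_distrib]
    refine Finset.sum_congr rfl fun i _ => Finset.sum_congr rfl fun j _ => ?_
    simp only [e]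
    ring
  have hi : ∀ i j : Fin 3, Integrable (fun y =>
      inner ℝ v (Q (e j) (e i)) * (inner ℝ (e i) y * inner ℝ (e j) y * ‖y‖⁻¹) -
      inner ℝ v y * inner ℝ (Q (e j) (e i)) y * inner ℝ (e i) y * inner ℝ (e j) y *
        (‖y‖ ^ 3)⁻¹) ballMeasure := fun i j => ((i2 _ _).const_mul _).sub (i4 _ _ _ _)
  simp only [hexp]
  rw [integral_finsetSum _ fun i _ => integrable_finsetSum _ fun j _ => hi i j]
  simp only [integral_finsetSum _ fun j _ => hi _ j]
  have hij : ∀ i j : Fin 3, ∫ y, (inner ℝ v (Q (e j) (e i)) *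
      (inner ℝ (e i) y * inner ℝ (e j) y * ‖y‖⁻¹) -
      inner ℝ v y * inner ℝ (Q (e j) (e i)) y * inner ℝ (e i) y * inner ℝ (e j) y *
        (‖y‖ ^ 3)⁻¹) ∂ballMeasure = _ := fun i j => by
    rw [integral_sub ((i2 _ _).const_mul _) (i4 _ _ _ _), integral_const_mul, h2, h4]
  simp only [hij]
  obtain ⟨q, hq⟩ : ∃ q : Fin 3 → Fin 3 → E3, ∀ i j, Q (e j) (e i) = q i j := ⟨_, fun _ _ => rfl⟩
  have hqs : ∀ i j, q i j = q j i := fun i j => by rw [← hq, ← hq, hQ]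
  change _ = _ * inner ℝ v (medianCoeff fun i j => Q (e j) (e i))
  simp only [hq, e, medianCoeff]
  simp [Fin.sum_univ_three, PiLp.inner_apply,
    hqs 1 0, hqs 2 0, hqs 2 1]
  ring

/-- Completing the square: the part quadratic in `Q` cancels in the difference, and `medianCoeff` is
the critical point. The positive factor makes it the strict minimiser. -/
theorem integral_normHessian_sub (Q : E3 →L[ℝ] E3 →L[ℝ] E3) (hQ : ∀ v w, Q v w = Q w v)
    {m : E3} (hm : m = medianCoeff fun i j =>
      Q (EuclideanSpace.single j 1) (EuclideanSpace.single i 1)) (c : E3) :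
    ∫ y, normHessian (c - (1 / 2 : ℝ) • Q y y) (c - (1 / 2 : ℝ) • Q y y) y ∂ballMeasure -
      ∫ y, normHessian (m - (1 / 2 : ℝ) • Q y y) (m - (1 / 2 : ℝ) • Q y y) y ∂ballMeasure =
    2 / 3 * (∫ y, ‖y‖⁻¹ ∂ballMeasure) * ‖c - m‖ ^ 2 := by
  have hcont : Continuous fun y => Q y y := by fun_prop
  have i1 := fun v w : E3 => integrable_normHessian (continuous_const (y := v))
    (continuous_const (y := w))
  have i2 := fun v : E3 => integrable_normHessian (continuous_const (y := v)) hcont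
  have hcq : ∀ c : E3, Continuous fun y => c - (1 / 2 : ℝ) • Q y y := fun c => by fun_prop
  rw [← integral_sub (integrable_normHessian (hcq c) (hcq c))
    (integrable_normHessian (hcq m) (hcq m))]
  have hpt : ∀ y, normHessian (c - (1 / 2 : ℝ) • Q y y) (c - (1 / 2 : ℝ) • Q y y) y -
      normHessian (m - (1 / 2 : ℝ) • Q y y) (m - (1 / 2 : ℝ) • Q y y) y =
      (normHessian c c y - normHessian m m y) - normHessian (c - m) (Q y y) y := fun y => by
    simp only [normHessian, inner_sub_left, inner_sub_right, inner_smul_left, inner_smul_right,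
      RCLike.conj_to_real, real_inner_comm c (Q y y), real_inner_comm m (Q y y)]
    ring
  simp only [hpt]
  have i3 : Integrable (fun y => normHessian c c y - normHessian m m y) ballMeasure :=
    (i1 c c).sub (i1 m m)
  rw [integral_sub i3 (i2 _), integral_sub (i1 c c) (i1 m m), integral_normHessian_const,
    integral_normHessian_const, integral_normHessian_quadratic Q hQ, ← hm,
    ← real_inner_self_eq_norm_sq]
  simp only [inner_sub_left, inner_sub_right, real_inner_comm c m]
  ring

/-! ### Second order difference quotient of the norm -/

/-- The second order difference quotient of the norm at `-y` in the direction `h`. -/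
noncomputable def normQuotient (ρ : ℝ) (h y : E3) : ℝ :=
  (‖ρ • h - y‖ - ‖y‖) / ρ ^ 2 + inner ℝ h y / (ρ * ‖y‖)

theorem norm_smul_sub_sq (ρ : ℝ) (h y : E3) :
    ‖ρ • h - y‖ ^ 2 = ρ ^ 2 * ‖h‖ ^ 2 - 2 * ρ * inner ℝ h y + ‖y‖ ^ 2 := by
  rw [norm_sub_sq_real, norm_smul, inner_smul_left, mul_pow, Real.norm_eq_abs, sq_abs,
    RCLike.conj_to_real]
  ring

theorem normQuotient_eq {ρ : ℝ} (hρ : ρ ≠ 0) (h : E3) {y : E3} (hy : y ≠ 0) :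
    normQuotient ρ h y = (‖h‖ ^ 2 - ((‖ρ • h - y‖ - ‖y‖) / ρ) ^ 2) / (2 * ‖y‖) := by
  have hy' : ‖y‖ ≠ 0 := norm_ne_zero_iff.2 hy
  have hN := norm_smul_sub_sq ρ h y
  unfold normQuotient
  field_simp
  linear_combination hN

/-- The reverse triangle inequality bounds the square in `normQuotient_eq` by `‖h‖²`. The bound is
independent of `ρ` and integrable in dimension three, so it serves as the dominating function
despite the singularity at `0`. -/
theorem abs_normQuotient_le {ρ : ℝ} (hρ : 0 < ρ) (h : E3) {y : E3} (hy : y ≠ 0) :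
    |normQuotient ρ h y| ≤ ‖h‖ ^ 2 / 2 * ‖y‖⁻¹ := by
  have hy' : 0 < ‖y‖ := norm_pos_iff.2 hy
  have h1 : ((‖ρ • h - y‖ - ‖y‖) / ρ) ^ 2 ≤ ‖h‖ ^ 2 := by
    rw [sq_le_sq, abs_norm, abs_div, abs_of_pos hρ, div_le_iff₀ hρ]
    have := abs_norm_sub_norm_le (ρ • h - y) (-y)
    rwa [norm_neg, sub_neg_eq_add, sub_add_cancel, norm_smul, Real.norm_of_nonneg hρ.le,
      mul_comm] at this
  rw [normQuotient_eq hρ.ne' h hy, abs_of_nonneg (div_nonneg (sub_nonneg.2 h1) (by positivity))]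
  calc _ ≤ ‖h‖ ^ 2 / (2 * ‖y‖) := by
        gcongr
        linarith [sq_nonneg ((‖ρ • h - y‖ - ‖y‖) / ρ)]
    _ = _ := by field_simp

theorem tendsto_normQuotient {ι : Type*} {l : Filter ι} {ρ : ι → ℝ} {h : ι → E3} {h₀ y : E3}
    (hρ : Tendsto ρ l (𝓝[>] 0)) (hh : Tendsto h l (𝓝 h₀)) (hy : y ≠ 0) :
    Tendsto (fun n => normQuotient (ρ n) (h n) y) l (𝓝 (1 / 2 * normHessian h₀ h₀ y)) := by
  have hy' : 0 < ‖y‖ := norm_pos_iff.2 hy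
  have hρ0 : Tendsto ρ l (𝓝 0) := hρ.mono_right nhdsWithin_le_nhds
  have hpos : ∀ᶠ n in l, 0 < ρ n := hρ.eventually self_mem_nhdsWithin
  have hS : Tendsto (fun n => ‖ρ n • h n - y‖ + ‖y‖) l (𝓝 (2 * ‖y‖)) := by
    have := ((hρ0.smul hh).sub_const y).norm.add_const ‖y‖
    rwa [zero_smul, zero_sub, norm_neg, ← two_mul] at this
  -- This is `(‖ρ h - y‖ - ‖y‖) / ρ` rationalised, so that no division by `ρ` remains.
  have hquot : Tendsto (fun n => (ρ n * ‖h n‖ ^ 2 - 2 * inner ℝ (h n) y) /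
      (‖ρ n • h n - y‖ + ‖y‖)) l (𝓝 ((0 * ‖h₀‖ ^ 2 - 2 * inner ℝ h₀ y) / (2 * ‖y‖))) :=
    ((hρ0.mul (hh.norm.pow 2)).sub ((hh.inner tendsto_const_nhds).const_mul 2)).div hS
      (by positivity)
  have hlim := ((hh.norm.pow 2).sub (hquot.pow 2)).div_const (2 * ‖y‖)
  have hval : 1 / 2 * normHessian h₀ h₀ y =
      (‖h₀‖ ^ 2 - ((0 * ‖h₀‖ ^ 2 - 2 * inner ℝ h₀ y) / (2 * ‖y‖)) ^ 2) / (2 * ‖y‖) := by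
    rw [normHessian, real_inner_self_eq_norm_sq]
    field_simp
    ring
  rw [hval]
  refine hlim.congr' ?_
  filter_upwards [hpos] with n hn
  rw [normQuotient_eq hn.ne' _ hy]
  have hden : ‖ρ n • h n - y‖ + ‖y‖ ≠ 0 := by positivity
  have : (ρ n * ‖h n‖ ^ 2 - 2 * inner ℝ (h n) y) / (‖ρ n • h n - y‖ + ‖y‖) =
      (‖ρ n • h n - y‖ - ‖y‖) / ρ n := by
    rw [div_eq_div_iff hden hn.ne']
    linear_combination -norm_smul_sub_sq (ρ n) (h n) y
  rw [this]

/-! ### Rescaled data and convergence of the functionals -/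

/-- The rescaled deviation of `f` from its linear part, when the derivative is the identity. -/
noncomputable def deviation (f : E3 → E3) (x₀ : E3) (ρ : ℝ) (y : E3) : E3 :=
  (ρ ^ 2)⁻¹ • (f (x₀ + ρ • y) - f x₀ - ρ • y)

/-- The derivative of `f` at `x₀` is the identity and the second derivative is `Q`, in the sense
of a second order expansion. -/
def HasExpansion (f : E3 → E3) (x₀ : E3) (Q : E3 →L[ℝ] E3 →L[ℝ] E3) : Prop :=
  (fun h => f (x₀ + h) - f x₀ - h - (1 / 2 : ℝ) • Q h h) =o[𝓝 0] fun h => ‖h‖ ^ 2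

theorem HasExpansion.deviation_sub_le {f : E3 → E3} {x₀ : E3} {Q : E3 →L[ℝ] E3 →L[ℝ] E3}
    (hf : HasExpansion f x₀ Q) {ε : ℝ} (hε : 0 < ε) : ∀ᶠ ρ in 𝓝[>] (0 : ℝ), ∀ y : E3, ‖y‖ < 1 →
      ‖deviation f x₀ ρ y - (1 / 2 : ℝ) • Q y y‖ ≤ ε := by
  obtain ⟨δ, hδ, hball⟩ := Metric.eventually_nhds_iff_ball.1 (Asymptotics.isLittleO_iff.1 hf hε)
  filter_upwards [Ioo_mem_nhdsGT hδ] with ρ hρ y hy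
  have hρ0 : 0 < ρ := hρ.1
  have hn : ‖ρ • y‖ ≤ ρ := by
    rw [norm_smul, Real.norm_of_nonneg hρ0.le]
    exact mul_le_of_le_one_right hρ0.le hy.le
  have h := hball (ρ • y) (by rw [mem_ball_zero_iff]; exact hn.trans_lt hρ.2)
  have heq : deviation f x₀ ρ y - (1 / 2 : ℝ) • Q y y =
      (ρ ^ 2)⁻¹ • (f (x₀ + ρ • y) - f x₀ - ρ • y - (1 / 2 : ℝ) • Q (ρ • y) (ρ • y)) := by
    simp only [deviation, map_smul, _root_.smul_apply, smul_sub, smul_smul]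
    congr 2
    field_simp
  rw [heq, norm_smul, norm_inv, norm_pow, Real.norm_of_nonneg hρ0.le,
    inv_mul_le_iff₀ (by positivity)]
  refine h.trans ?_
  rw [norm_pow, norm_norm, mul_comm]
  gcongr

theorem HasExpansion.tendsto_deviation {f : E3 → E3} {x₀ : E3} {Q : E3 →L[ℝ] E3 →L[ℝ] E3}
    (hf : HasExpansion f x₀ Q) {y : E3} (hy : ‖y‖ < 1) :
    Tendsto (fun ρ => deviation f x₀ ρ y) (𝓝[>] 0) (𝓝 ((1 / 2 : ℝ) • Q y y)) := by
  rw [Metric.tendsto_nhds]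
  intro ε hε
  filter_upwards [hf.deviation_sub_le (half_pos hε)] with ρ hρ
  rw [dist_eq_norm]
  linarith [hρ y hy]

theorem HasExpansion.norm_deviation_le {f : E3 → E3} {x₀ : E3} {Q : E3 →L[ℝ] E3 →L[ℝ] E3}
    (hf : HasExpansion f x₀ Q) : ∀ᶠ ρ in 𝓝[>] (0 : ℝ), ∀ y : E3, ‖y‖ < 1 →
      ‖deviation f x₀ ρ y‖ ≤ ‖Q‖ + 1 := by
  filter_upwards [hf.deviation_sub_le one_pos] with ρ hρ y hy
  have h1 : ‖(1 / 2 : ℝ) • Q y y‖ ≤ ‖Q‖ := by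
    rw [norm_smul]
    have h2 : ‖Q y y‖ ≤ ‖Q‖ * 1 * 1 := (Q.le_opNorm₂ y y).trans (by gcongr)
    norm_num
    linarith [norm_nonneg (Q y y)]
  have := norm_add_le (deviation f x₀ ρ y - (1 / 2 : ℝ) • Q y y) ((1 / 2 : ℝ) • Q y y)
  rw [sub_add_cancel] at this
  linarith [hρ y hy]

theorem continuousOn_comp_add_smul {f : E3 → E3} {x₀ : E3} {ρ : ℝ} (hρ : 0 < ρ)
    (hf : ContinuousOn f (Metric.closedBall x₀ ρ)) :
    ContinuousOn (fun y => f (x₀ + ρ • y)) (Metric.closedBall 0 1) := by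
  refine hf.comp (by fun_prop) fun y hy => ?_
  rw [mem_closedBall_zero_iff] at hy
  rw [mem_closedBall_iff_norm, add_sub_cancel_left, norm_smul, Real.norm_of_nonneg hρ.le]
  exact mul_le_of_le_one_right hρ.le hy

theorem measurable_normQuotient (ρ : ℝ) :
    Measurable fun p : E3 × E3 => normQuotient ρ p.1 p.2 := by
  unfold normQuotient
  fun_prop

theorem aestronglyMeasurable_normQuotient {f : E3 → E3} {x₀ : E3} {ρ : ℝ} (hρ : 0 < ρ)
    (hf : ContinuousOn f (Metric.closedBall x₀ ρ)) (c : E3) :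
    AEStronglyMeasurable (fun y => normQuotient ρ (c - deviation f x₀ ρ y) y) ballMeasure := by
  have h1 : AEMeasurable (fun y => f (x₀ + ρ • y)) (volume.restrict (Metric.ball 0 1)) :=
    ((continuousOn_comp_add_smul hρ hf).mono Metric.ball_subset_closedBall).aemeasurable
      Metric.isOpen_ball.measurableSet
  have h2 : AEMeasurable (fun y => f (x₀ + ρ • y)) ballMeasure := h1
  have h3 : AEMeasurable (fun y : E3 => ρ • y) ballMeasure := by fun_prop
  have h4 : AEMeasurable (fun y => f (x₀ + ρ • y) - f x₀ - ρ • y) ballMeasure :=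
    (h2.sub_const (f x₀)).sub h3
  have h5 : AEMeasurable (fun y => deviation f x₀ ρ y) ballMeasure := by
    unfold deviation
    exact h4.const_smul (ρ ^ 2)⁻¹
  have h6 := h5.const_sub c
  exact ((measurable_normQuotient ρ).comp_aemeasurable
    (h6.prodMk aemeasurable_id)).aestronglyMeasurable

theorem HasExpansion.tendsto_integral_normQuotient {f : E3 → E3} {x₀ : E3}
    {Q : E3 →L[ℝ] E3 →L[ℝ] E3} (hf : HasExpansion f x₀ Q)
    (hcont : ∀ᶠ ρ in 𝓝[>] (0 : ℝ), ContinuousOn f (Metric.closedBall x₀ ρ))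
    {ι : Type*} {l : Filter ι} [l.IsCountablyGenerated] {ρ : ι → ℝ} {c : ι → E3} {c₀ : E3}
    (hρ : Tendsto ρ l (𝓝[>] 0)) (hc : Tendsto c l (𝓝 c₀)) :
    Tendsto (fun n => ∫ y, normQuotient (ρ n) (c n - deviation f x₀ (ρ n) y) y ∂ballMeasure) l
      (𝓝 (∫ y, 1 / 2 * normHessian (c₀ - (1 / 2 : ℝ) • Q y y) (c₀ - (1 / 2 : ℝ) • Q y y) y
        ∂ballMeasure)) := by
  have hpos : ∀ᶠ n in l, 0 < ρ n := hρ.eventually self_mem_nhdsWithin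
  refine tendsto_integral_filter_of_dominated_convergence
    (fun y => (‖c₀‖ + 1 + (‖Q‖ + 1)) ^ 2 / 2 * ‖y‖⁻¹) ?_ ?_ (integrable_inv_norm.const_mul _) ?_
  · filter_upwards [hpos, hρ.eventually hcont] with n hn hn'
    exact aestronglyMeasurable_normQuotient hn hn' _
  · have hcb : ∀ᶠ n in l, ‖c n‖ < ‖c₀‖ + 1 := hc.norm.eventually_lt_const (by linarith)
    filter_upwards [hpos, hρ.eventually hf.norm_deviation_le, hcb] with n hn hdev hcn
    filter_upwards [ae_ballMeasure_norm_lt, ae_ballMeasure_ne_zero] with y hy hy0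
    refine (abs_normQuotient_le hn _ hy0).trans ?_
    gcongr
    exact (norm_sub_le _ _).trans (add_le_add hcn.le (hdev y hy))
  · filter_upwards [ae_ballMeasure_norm_lt, ae_ballMeasure_ne_zero] with y hy hy0
    exact tendsto_normQuotient hρ (hc.sub ((hf.tendsto_deviation hy).comp hρ)) hy0

/-! ### Passage from the ball of radius `ρ` to the unit ball -/

open scoped Pointwise in
theorem setIntegral_closedBall_eq (F : E3 → ℝ) (x₀ : E3) {ρ : ℝ} (hρ : 0 < ρ) :
    ∫ x in Metric.closedBall x₀ ρ, F x = ρ ^ 3 * ∫ y, F (x₀ + ρ • y) ∂ballMeasure := by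
  have hball : (Metric.closedBall (0 : E3) 1 : Set E3) =ᵐ[volume] Metric.ball 0 1 :=
    (ae_eq_of_subset_of_measure_ge Metric.ball_subset_closedBall
      (Measure.addHaar_closedBall_eq_addHaar_ball _ _ _).le
      Metric.isOpen_ball.measurableSet.nullMeasurableSet measure_closedBall_lt_top.ne).symm
  have h1 := Measure.setIntegral_comp_smul_of_pos volume (fun x => F (x₀ + x))
    (Metric.closedBall (0 : E3) 1) hρ
  have h2 : ∫ x in ρ • Metric.closedBall (0 : E3) 1, F (x₀ + x) =
      ∫ x in Metric.closedBall x₀ ρ, F x := by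
    have h := (measurePreserving_add_left volume x₀).setIntegral_preimage_emb
      (Homeomorph.addLeft x₀).measurableEmbedding F (Metric.closedBall x₀ ρ)
    rw [preimage_add_closedBall, sub_self] at h
    rw [smul_closedBall _ _ zero_le_one, smul_zero, mul_one, Real.norm_of_nonneg hρ.le, h]
  rw [ballMeasure, ← setIntegral_congr_set hball, h1, h2, finrank_euclideanSpace_fin, smul_eq_mul,
    mul_inv_cancel_left₀ (by positivity)]

theorem integral_inner_div_norm (v : E3) (t : ℝ) :
    ∫ y, inner ℝ v y / (t * ‖y‖) ∂ballMeasure = 0 := by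
  have h := integral_ballMeasure_comp_isometry (LinearIsometryEquiv.neg ℝ)
    fun y => inner ℝ v y / (t * ‖y‖)
  simp only [LinearIsometryEquiv.coe_neg, inner_neg_right, norm_neg, neg_div, integral_neg] at h
  linarith

theorem integrable_inner_div_norm (v : E3) (t : ℝ) :
    Integrable (fun y => inner ℝ v y / (t * ‖y‖)) ballMeasure := by
  refine (integrable_const (‖v‖ * |t|⁻¹)).mono' (by fun_prop : Measurable _).aestronglyMeasurable
    (Eventually.of_forall fun y => ?_)
  rw [norm_div, norm_mul, norm_norm, Real.norm_eq_abs, Real.norm_eq_abs]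
  calc _ ≤ ‖v‖ * ‖y‖ / (|t| * ‖y‖) := by
        gcongr; exact abs_real_inner_le_norm _ _
    _ = ‖v‖ * |t|⁻¹ * (‖y‖ / ‖y‖) := by ring
    _ ≤ _ := mul_le_of_le_one_right (by positivity) (div_self_le_one _)

/-- In the first order terms the deviation cancels, leaving only `c - d`, whose contribution is odd
in `y`. Thus integrated quotients are ordered as the original functionals are. -/
theorem normQuotient_sub (f : E3 → E3) (x₀ : E3) {ρ : ℝ} (hρ : 0 < ρ) (c d y : E3) :
    normQuotient ρ (c - deviation f x₀ ρ y) y - normQuotient ρ (d - deviation f x₀ ρ y) y =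
      (ρ ^ 3)⁻¹ * (‖f x₀ + ρ ^ 2 • c - f (x₀ + ρ • y)‖ - ‖f x₀ + ρ ^ 2 • d - f (x₀ + ρ • y)‖) +
      inner ℝ (c - d) y / (ρ * ‖y‖) := by
  have h : ∀ c : E3, ‖ρ • (c - deviation f x₀ ρ y) - y‖ =
      ρ⁻¹ * ‖f x₀ + ρ ^ 2 • c - f (x₀ + ρ • y)‖ := fun c => by
    have : ρ • (c - deviation f x₀ ρ y) - y =
        ρ⁻¹ • (f x₀ + ρ ^ 2 • c - f (x₀ + ρ • y)) := by
      have e1 : ρ * (ρ ^ 2)⁻¹ = ρ⁻¹ := by field_simp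
      have e2 : ρ⁻¹ * ρ ^ 2 = ρ := by field_simp
      have e3 : ρ * ((ρ ^ 2)⁻¹ * ρ) = 1 := by field_simp
      simp only [deviation, smul_sub, smul_add, smul_smul, e1, e2, e3, one_smul]
      abel
    rw [this, norm_smul, norm_inv, Real.norm_of_nonneg hρ.le]
  simp only [normQuotient, h, inner_sub_left]
  field_simp
  ring

theorem integral_normQuotient_le {f : E3 → E3} {x₀ : E3} {ρ : ℝ} (hρ : 0 < ρ)
    (hf : ContinuousOn f (Metric.closedBall x₀ ρ)) {c d : E3}
    (hint : Integrable (fun y => normQuotient ρ (d - deviation f x₀ ρ y) y) ballMeasure)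
    (h : ∫ x in Metric.closedBall x₀ ρ, ‖f x₀ + ρ ^ 2 • c - f x‖ ≤
      ∫ x in Metric.closedBall x₀ ρ, ‖f x₀ + ρ ^ 2 • d - f x‖) :
    ∫ y, normQuotient ρ (c - deviation f x₀ ρ y) y ∂ballMeasure ≤
      ∫ y, normQuotient ρ (d - deviation f x₀ ρ y) y ∂ballMeasure := by
  have hi : ∀ m : E3, Integrable (fun y => ‖m - f (x₀ + ρ • y)‖) ballMeasure := fun m =>
    (integrableOn_norm_sub (isCompact_closedBall 0 1) (continuousOn_comp_add_smul hρ hf) m).mono_set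
      Metric.ball_subset_closedBall
  rw [setIntegral_closedBall_eq _ _ hρ, setIntegral_closedBall_eq _ _ hρ,
    mul_le_mul_iff_right₀ (by positivity)] at h
  have hpt : (fun y => normQuotient ρ (c - deviation f x₀ ρ y) y) = fun y =>
      normQuotient ρ (d - deviation f x₀ ρ y) y + ((ρ ^ 3)⁻¹ *
        (‖f x₀ + ρ ^ 2 • c - f (x₀ + ρ • y)‖ - ‖f x₀ + ρ ^ 2 • d - f (x₀ + ρ • y)‖) +
      inner ℝ (c - d) y / (ρ * ‖y‖)) := by
    funext y
    rw [← normQuotient_sub f x₀ hρ]; ring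
  have hi1 := ((hi (f x₀ + ρ ^ 2 • c)).sub (hi (f x₀ + ρ ^ 2 • d))).const_mul (ρ ^ 3)⁻¹
  have hi2 := integrable_inner_div_norm (c - d) ρ
  have hz : ∫ y, ((ρ ^ 3)⁻¹ *
      (‖f x₀ + ρ ^ 2 • c - f (x₀ + ρ • y)‖ - ‖f x₀ + ρ ^ 2 • d - f (x₀ + ρ • y)‖) +
      inner ℝ (c - d) y / (ρ * ‖y‖)) ∂ballMeasure ≤ 0 := by
    have hadd := integral_add hi1 hi2
    rw [integral_inner_div_norm, integral_const_mul, add_zero] at hadd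
    refine hadd.trans_le (mul_nonpos_of_nonneg_of_nonpos (by positivity) ?_)
    have := integral_sub (hi (f x₀ + ρ ^ 2 • c)) (hi (f x₀ + ρ ^ 2 • d))
    exact this.trans_le (by linarith)
  rw [hpt]
  have hi3 : Integrable (fun y => (ρ ^ 3)⁻¹ * (‖f x₀ + ρ ^ 2 • c - f (x₀ + ρ • y)‖ -
      ‖f x₀ + ρ ^ 2 • d - f (x₀ + ρ • y)‖) + inner ℝ (c - d) y / (ρ * ‖y‖)) ballMeasure :=
    hi1.add hi2
  have := integral_add hint hi3
  exact this.trans_le (by linarith [hz])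

theorem HasExpansion.integrable_normQuotient {f : E3 → E3} {x₀ : E3}
    {Q : E3 →L[ℝ] E3 →L[ℝ] E3} (hf : HasExpansion f x₀ Q)
    (hcont : ∀ᶠ ρ in 𝓝[>] (0 : ℝ), ContinuousOn f (Metric.closedBall x₀ ρ)) (d : E3) :
    ∀ᶠ ρ in 𝓝[>] (0 : ℝ),
      Integrable (fun y => normQuotient ρ (d - deviation f x₀ ρ y) y) ballMeasure := by
  filter_upwards [self_mem_nhdsWithin, hcont, hf.norm_deviation_le] with ρ hρ hc hdev
  refine (integrable_inv_norm.const_mul ((‖d‖ + (‖Q‖ + 1)) ^ 2 / 2)).mono'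
    (aestronglyMeasurable_normQuotient hρ hc d) ?_
  filter_upwards [ae_ballMeasure_norm_lt, ae_ballMeasure_ne_zero] with y hy hy0
  refine (abs_normQuotient_le hρ _ hy0).trans ?_
  gcongr
  exact (norm_sub_le _ _).trans (add_le_add le_rfl (hdev y hy))

/-! ### Convergence of the rescaled medians -/

/-- Asymptotics of the `L¹` median of the data in a shrinking ball. -/
theorem HasExpansion.tendsto_isL1Median {f : E3 → E3} {x₀ : E3}
    {Q : E3 →L[ℝ] E3 →L[ℝ] E3} (hf : HasExpansion f x₀ Q) (hQ : ∀ v w, Q v w = Q w v)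
    (hcont : ∀ᶠ ρ in 𝓝[>] (0 : ℝ), ContinuousOn f (Metric.closedBall x₀ ρ))
    {m : ℝ → E3} (hm : ∀ᶠ ρ in 𝓝[>] (0 : ℝ), IsL1Median (Metric.closedBall x₀ ρ) f (m ρ)) :
    Tendsto (fun ρ => (ρ ^ 2)⁻¹ • (m ρ - f x₀)) (𝓝[>] 0) (𝓝 (medianCoeff fun i j =>
      Q (EuclideanSpace.single j 1) (EuclideanSpace.single i 1))) := by
  set c₀ := medianCoeff fun i j =>
    Q (EuclideanSpace.single j 1) (EuclideanSpace.single i 1) with hc₀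
  rw [Metric.tendsto_nhds]
  intro ε hε
  by_contra hnot
  obtain ⟨ρ, hρ, hfar⟩ := exists_seq_forall_of_frequently
    (not_eventually.1 hnot)
  let c : ℕ → E3 := fun n => (ρ n ^ 2)⁻¹ • (m (ρ n) - f x₀)
  have hcε : ∀ n, ε ≤ ‖c n - c₀‖ := fun n => by
    rw [← dist_eq_norm]; exact not_lt.1 (hfar n)
  -- Pulling `c n` back along the segment to the sphere of radius `ε` around `c₀` gives compactness
  -- without an a priori bound on the medians.
  let t : ℕ → ℝ := fun n => ε / ‖c n - c₀‖
  have ht0 : ∀ n, 0 ≤ t n := fun n => by positivity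
  have ht1 : ∀ n, t n ≤ 1 := fun n => div_le_one_of_le₀ (hcε n) (norm_nonneg _)
  let d : ℕ → E3 := fun n => c₀ + t n • (c n - c₀)
  have hd : ∀ n, d n ∈ Metric.sphere c₀ ε := fun n => by
    have : ‖c n - c₀‖ ≠ 0 := (hε.trans_le (hcε n)).ne'
    rw [mem_sphere_iff_norm]
    simp only [d, t, add_sub_cancel_left]
    rw [norm_smul, Real.norm_of_nonneg (by positivity)]
    field_simp
  obtain ⟨d₀, hd₀, φ, hφ, hlim⟩ := (isCompact_sphere c₀ ε).tendsto_subseq hd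
  have hρφ : Tendsto (ρ ∘ φ) atTop (𝓝[>] 0) := hρ.comp hφ.tendsto_atTop
  -- By convexity, a point between `c₀` and a minimiser has value at most that of `c₀`. In the limit
  -- this contradicts the strict excess on the sphere.
  have hle : ∀ᶠ n in atTop,
      ∫ y, normQuotient (ρ (φ n)) (d (φ n) - deviation f x₀ (ρ (φ n)) y) y ∂ballMeasure ≤
      ∫ y, normQuotient (ρ (φ n)) (c₀ - deviation f x₀ (ρ (φ n)) y) y ∂ballMeasure := by
    filter_upwards [hρφ.eventually self_mem_nhdsWithin, hρφ.eventually hcont,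
      hρφ.eventually (hf.integrable_normQuotient hcont c₀), hρφ.eventually hm] with n hn hcn hin hmn
    refine integral_normQuotient_le hn hcn hin ?_
    have hn' : ρ (φ n) ≠ 0 := (show 0 < ρ (φ n) from hn).ne'
    have hconv := (convexOn_integral_norm_sub (isCompact_closedBall x₀ _) hcn).2
      (Set.mem_univ (f x₀ + ρ (φ n) ^ 2 • c₀)) (Set.mem_univ (m (ρ (φ n))))
      (sub_nonneg.2 (ht1 (φ n))) (ht0 (φ n)) (by ring)
    have hcomb : (1 - t (φ n)) • (f x₀ + ρ (φ n) ^ 2 • c₀) + t (φ n) • m (ρ (φ n)) =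
        f x₀ + ρ (φ n) ^ 2 • d (φ n) := by
      have : m (ρ (φ n)) = f x₀ + ρ (φ n) ^ 2 • c (φ n) := by
        simp only [c]
        rw [smul_inv_smul₀ (pow_ne_zero 2 hn')]
        abel
      rw [this]
      simp only [d]
      module
    simp only [Function.comp_apply, hcomb, smul_eq_mul] at hconv
    refine hconv.trans ?_
    have := mul_le_mul_of_nonneg_left (hmn.integral_le (f x₀ + ρ (φ n) ^ 2 • c₀)) (ht0 (φ n))
    simp only [Function.comp_apply] at this ⊢
    linarith
  have hL := le_of_tendsto_of_tendsto (hf.tendsto_integral_normQuotient hcont hρφ hlim)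
    (hf.tendsto_integral_normQuotient hcont hρφ tendsto_const_nhds) hle
  rw [integral_const_mul, integral_const_mul] at hL
  have hdiff := integral_normHessian_sub Q hQ hc₀ d₀
  rw [mem_sphere_iff_norm.1 hd₀] at hdiff
  have hpos : 0 < 2 / 3 * (∫ y, ‖y‖⁻¹ ∂ballMeasure) * ε ^ 2 := by
    have := integral_inv_norm_pos
    positivity
  linarith

/-! ### Application to the transformed data -/

section AffineData

variable {u : E3 → E3} {x₀ : E3}

theorem hasExpansion_act_inv_jacobian (hu : ContDiffAt ℝ 2 u x₀)
    (hdet : (jacobian u x₀).det ≠ 0) :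
    HasExpansion (fun x => act (jacobian u x₀)⁻¹ (u x)) x₀
      ((ContinuousLinearMap.compL ℝ E3 E3 E3 (actCLM (jacobian u x₀)⁻¹)).comp
        (fderiv ℝ (fderiv ℝ u) x₀)) := by
  set D := jacobian u x₀ with hD
  refine (((actCLM D⁻¹).isBigO_comp _ _).trans_isLittleO (taylor_two_isLittleO hu)).congr_left
    fun h => ?_
  have h1 : actCLM D⁻¹ (fderiv ℝ u x₀ h) = h := by
    rw [fderiv_eq_act_jacobian, ← hD, actCLM_apply, act_act,
      Matrix.nonsing_inv_mul D (isUnit_iff_ne_zero.2 hdet), act_one]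
  simp only [map_sub, map_smul, h1]
  rfl

theorem hasFDerivAt_act_inv_jacobian (hu : DifferentiableAt ℝ u x₀)
    (hdet : (jacobian u x₀).det ≠ 0) :
    HasFDerivAt (fun x => act (jacobian u x₀)⁻¹ (u x)) (ContinuousLinearMap.id ℝ E3) x₀ := by
  refine ((actCLM (jacobian u x₀)⁻¹).hasFDerivAt.comp x₀ hu.hasFDerivAt).congr_fderiv ?_
  ext1 h
  rw [ContinuousLinearMap.comp_apply, fderiv_eq_act_jacobian, actCLM_apply, act_act,
    Matrix.nonsing_inv_mul _ (isUnit_iff_ne_zero.2 hdet), act_one, ContinuousLinearMap.id_apply]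

theorem continuousOn_act {s : Set E3} (hu : ContinuousOn u s) (A : Matrix (Fin 3) (Fin 3) ℝ) :
    ContinuousOn (fun x => act A (u x)) s :=
  (actCLM A).continuous.comp_continuousOn hu

end AffineData

theorem mainTheorem4 (Ω : Set E3) (hΩ : IsOpen Ω) (u : E3 → E3) (hu : ContDiffOn ℝ 2 u Ω)
    (x₀ : E3) (hx₀ : x₀ ∈ Ω) (hdet : (jacobian u x₀).det ≠ 0) :
    (∀ ρ : ℝ, 0 < ρ → Metric.closedBall x₀ ρ ⊆ Ω →
      ∃! m : E3, IsAffineL1MedianFilterValue u ρ x₀ m) ∧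
    ∀ m : ℝ → E3,
      (∀ ρ : ℝ, 0 < ρ → Metric.closedBall x₀ ρ ⊆ Ω →
        IsAffineL1MedianFilterValue u ρ x₀ (m ρ)) →
      (fun ρ : ℝ => m ρ - (u x₀ + (ρ ^ 2 / 60) • medianPDE u x₀))
        =o[𝓝[>] (0 : ℝ)] (fun ρ : ℝ => ρ ^ 2) := by
  have hu₀ : ContDiffAt ℝ 2 u x₀ := hu.contDiffAt (hΩ.mem_nhds hx₀)
  set D := jacobian u x₀ with hD
  have hcont : ∀ ρ, Metric.closedBall x₀ ρ ⊆ Ω →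
      ContinuousOn (fun x => act D⁻¹ (u x)) (Metric.closedBall x₀ ρ) := fun ρ hρ =>
    continuousOn_act (hu.continuousOn.mono hρ) _
  refine ⟨fun ρ hρ hsub => ?_, fun m hm => ?_⟩
  · obtain ⟨mhat, hmhat⟩ := exists_isL1Median (isCompact_closedBall x₀ ρ)
      (Metric.measure_closedBall_pos volume x₀ hρ).ne' (hcont ρ hsub)
    refine ⟨act D mhat, ⟨mhat, hmhat, rfl⟩, ?_⟩
    rintro _ ⟨nhat, hnhat, rfl⟩
    rw [IsL1Median.unique (isCompact_closedBall x₀ ρ) (hcont ρ hsub)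
      (Metric.closedBall_mem_nhds x₀ hρ)
      (hasFDerivAt_act_inv_jacobian (hu₀.differentiableAt (by norm_num)) hdet) hnhat hmhat]
  · have hsub : ∀ᶠ ρ in 𝓝[>] (0 : ℝ), Metric.closedBall x₀ ρ ⊆ Ω := by
      obtain ⟨δ, hδ, hball⟩ := Metric.isOpen_iff.1 hΩ x₀ hx₀
      filter_upwards [Ioo_mem_nhdsGT hδ] with ρ hρ
      exact (Metric.closedBall_subset_ball hρ.2).trans hball
    have hDD : D * D⁻¹ = 1 := Matrix.mul_nonsing_inv D (isUnit_iff_ne_zero.2 hdet)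
    have hDD' : D⁻¹ * D = 1 := Matrix.nonsing_inv_mul D (isUnit_iff_ne_zero.2 hdet)
    have hlim := (hasExpansion_act_inv_jacobian hu₀ hdet).tendsto_isL1Median
      (fun v w => congrArg (actCLM D⁻¹) ((hu₀.isSymmSndFDerivAt (by simp)) v w))
      (hsub.mono fun ρ hρ => hcont ρ hρ) (m := fun ρ => act D⁻¹ (m ρ)) (by
        filter_upwards [self_mem_nhdsWithin, hsub] with ρ hρ hs
        obtain ⟨mhat, hmhat, h⟩ := hm ρ hρ hs
        rwa [h, act_act, hDD', act_one])
    have hcoeff : (medianCoeff fun i j => ((ContinuousLinearMap.compL ℝ E3 E3 E3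
        (actCLM (jacobian u x₀)⁻¹)).comp (fderiv ℝ (fderiv ℝ u) x₀))
          (EuclideanSpace.single j 1) (EuclideanSpace.single i 1)) =
        medianCoeff fun i j => act D⁻¹ (pd2 i j u x₀) := by
      simp only [pd2_eq_fderiv_fderiv hu₀]
      rfl
    rw [hcoeff] at hlim
    -- Transforming back by `D` turns the limit of the rescaled medians into one sixtieth of the PDE
    -- right-hand side.
    have hlim' := ((actCLM D).continuous.tendsto _).comp hlim
    have hzero := (Asymptotics.isLittleO_one_iff ℝ).2 (tendsto_sub_nhds_zero_iff.2 hlim')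
    refine ((Asymptotics.isBigO_refl (fun ρ : ℝ => ρ ^ 2) _).smul_isLittleO hzero).congr' ?_
      (Eventually.of_forall fun ρ => by simp)
    filter_upwards [self_mem_nhdsWithin] with ρ hρ
    have hρ' : ρ ^ 2 ≠ 0 := pow_ne_zero 2 (show (0 : ℝ) < ρ from hρ).ne'
    rw [medianPDE_eq_act hu₀ hdet, ← hD, Function.comp_apply, map_smul, map_sub]
    simp only [actCLM_apply, act_act, hDD, act_one]
    rw [smul_sub, smul_inv_smul₀ hρ']
    module
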